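/- A geometric graph is a graph whose vertices form a finite set of points in $\mathbb{R}^2$, whose edges are straight line segments joining pairs of vertices, and in which no vertex lies in the interior of an edge; it is complete if every two of its vertices are joined by an edge. Two geometric subgraphs cross if there are an edge of the first and an edge of the second that have exactly one interior point in common. Let $P_4$ denote the path on $4$ vertices. A $P_4$-intersecting family of a geometric graph is a set of subgraphs of it, each isomorphic to $P_4$, any two of which are edge-disjoint and cross. Theorem. Let $n \ge 4$ and let $\mathsf{K}_n$ be a complete geometric graph on $n$ points in the plane, no three of which are collinear. Then $\mathsf{K}_n$ contains a $P_4$-intersecting family of size at least $\frac{n^2}{400}$. -/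

import Mathlib

/-- The Euclidean plane. -/
abbrev Plane : Type := EuclideanSpace ℝ (Fin 2)

/-- A set of points is in general position if no three (distinct) points of it are collinear. -/
def InGeneralPosition (S : Finset Plane) : Prop :=
  ∀ p ∈ S, ∀ q ∈ S, ∀ r ∈ S, p ≠ q → p ≠ r → q ≠ r → ¬ Collinear ℝ {p, q, r}

/-- A geometric graph: a finite set of points in the plane, some pairs of which are joined by
straight line segments, such that no vertex lies in the interior of an edge. -/
structure GeometricGraph where
  /-- the points of the graph -/
  verts : Finset Plane
  /-- which pairs of points are joined by a segment -/
  graph : SimpleGraph verts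
  vertex_notMem_interior : ∀ u v w : verts, graph.Adj u v →
    (w : Plane) ∉ openSegment ℝ (u : Plane) (v : Plane)

namespace GeometricGraph

/-- A geometric graph is complete if there is an edge between any two of its points. -/
def IsComplete (G : GeometricGraph) : Prop :=
  ∀ u v : G.verts, u ≠ v → G.graph.Adj u v

/-- Two geometric subgraphs cross if some edge of the first and some edge of the second have
exactly one interior point in common. -/
def Cross (G : GeometricGraph) (A B : G.graph.Subgraph) : Prop :=
  ∃ a b c d : G.verts, A.Adj a b ∧ B.Adj c d ∧
    ∃ x : Plane, openSegment ℝ (a : Plane) (b : Plane) ∩ openSegment ℝ (c : Plane) (d : Plane) = {x}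

/-- An `H`-intersecting family: subgraphs isomorphic to `H`, any two of which are edge-disjoint
and cross. -/
structure IsIntersectingFamily (G : GeometricGraph) {W : Type*} (H : SimpleGraph W)
    (F : Finset G.graph.Subgraph) : Prop where
  iso : ∀ A ∈ F, Nonempty (H ≃g A.coe)
  edge_disjoint : ∀ A ∈ F, ∀ B ∈ F, A ≠ B → Disjoint A.edgeSet B.edgeSet
  cross : ∀ A ∈ F, ∀ B ∈ F, A ≠ B → G.Cross A B

end GeometricGraph

/-! Choose coordinates with distinct abscissas and index the paths by pairs `(i, j)`: a `zigzag`
path `e i, g j, f i, h j` alternates between a vertex chosen by `i` and one chosen by `j`. When all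
chosen vertices are distinct, every edge reveals both indices, so different paths are edge-disjoint
and two classes of linear size give quadratically many paths.

Crossing is forced by vertical order. If each `g j` lies below its own segment `f i, h j` and every
`e` above all such segments, two paths cross (`hasCrossingPaths_of_below`): either some `g` is below
the other path's segment, so its edge to `e` crosses that segment, or the two segments change order
between the two `g`s. `hasCrossingPaths_of_above` is a variant.

Such positions come from bisecting twice. The points are cut by abscissa into left, middle and
right; a line halves left and right, and up to reflection enough middle points lie above it, hence
above every segment between low left and low right points (`hasCrossingPaths_of_isAdmissible`). A
second line splits parts of the two sides, and a case distinction yields one of three zigzag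
families (`hasCrossingPaths_of_above_line`). Optimizing the class sizes gives the constant 400. -/

/-! ### Vertical order of points and segments -/

section Ordinates

variable {V : Type*} (X Y : V → ℝ)

/-- The ordinate at abscissa `s` of the line through the points of `a` and `b`. -/
noncomputable def lineAt (a b : V) (s : ℝ) : ℝ :=
  Y a + (Y b - Y a) / (X b - X a) * (s - X a)

/-- The segments `ab` and `cd` change their vertical order between two abscissas that they share. -/
def SegCross (a b c d : V) : Prop :=
  ∃ s t : ℝ, s ∈ Set.uIcc (X a) (X b) ∧ s ∈ Set.uIcc (X c) (X d) ∧
    t ∈ Set.uIcc (X a) (X b) ∧ t ∈ Set.uIcc (X c) (X d) ∧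
    lineAt X Y a b s < lineAt X Y c d s ∧ lineAt X Y c d t < lineAt X Y a b t

/-- No point lies on a line through two other points. -/
def NoThreeOnLine : Prop :=
  ∀ a b c : V, a ≠ b → c ≠ a → c ≠ b → lineAt X Y a b (X c) ≠ Y c

variable {X Y}

@[simp] lemma lineAt_left (a b : V) : lineAt X Y a b (X a) = Y a := by simp [lineAt]

lemma lineAt_right {a b : V} (h : X a ≠ X b) : lineAt X Y a b (X b) = Y b := by
  have : X b - X a ≠ 0 := sub_ne_zero.2 h.symm
  simp [lineAt, div_mul_cancel₀ _ this]

lemma lineAt_comm {a b : V} (h : X a ≠ X b) (s : ℝ) : lineAt X Y a b s = lineAt X Y b a s := by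
  have h1 : X b - X a ≠ 0 := sub_ne_zero.2 h.symm
  have h2 : X a - X b ≠ 0 := sub_ne_zero.2 h
  simp only [lineAt]
  field_simp
  ring

/-- Reflection in the horizontal axis, later used to assume that the middle points lie above the
bisecting line. -/
lemma lineAt_neg (a b : V) (s : ℝ) : lineAt X (-Y) a b s = -lineAt X Y a b s := by
  simp only [lineAt, Pi.neg_apply]
  ring

lemma NoThreeOnLine.neg (h : NoThreeOnLine X Y) : NoThreeOnLine X (-Y) := by
  intro a b c hab hca hcb he
  rw [lineAt_neg, Pi.neg_apply, neg_inj] at he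
  exact h a b c hab hca hcb he

lemma SegCross.symm {a b c d : V} : SegCross X Y a b c d → SegCross X Y c d a b := by
  rintro ⟨s, t, h1, h2, h3, h4, h5, h6⟩
  exact ⟨t, s, h4, h3, h2, h1, h6, h5⟩

lemma SegCross.of_neg {a b c d : V} : SegCross X (-Y) a b c d → SegCross X Y a b c d := by
  rintro ⟨s, t, h1, h2, h3, h4, h5, h6⟩
  simp only [lineAt_neg, neg_lt_neg_iff] at h5 h6
  exact ⟨t, s, h3, h4, h1, h2, h6, h5⟩

lemma lineAt_le_of_endpoints_le {a b : V} {m k s : ℝ} (hab : X a < X b)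
    (hs : s ∈ Set.Icc (X a) (X b)) (ha : Y a ≤ m * X a + k) (hb : Y b ≤ m * X b + k) :
    lineAt X Y a b s ≤ m * s + k := by
  have h0 : 0 < X b - X a := sub_pos.2 hab
  have e : lineAt X Y a b s =
      (Y a * (X b - s) + Y b * (s - X a)) / (X b - X a) := by
    simp only [lineAt]
    field_simp
    ring
  rw [e, div_le_iff₀ h0]
  nlinarith [mul_le_mul_of_nonneg_right ha (sub_nonneg.2 hs.2),
    mul_le_mul_of_nonneg_right hb (sub_nonneg.2 hs.1)]

lemma le_lineAt_of_le_endpoints {a b : V} {m k s : ℝ} (hab : X a < X b)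
    (hs : s ∈ Set.Icc (X a) (X b)) (ha : m * X a + k ≤ Y a) (hb : m * X b + k ≤ Y b) :
    m * s + k ≤ lineAt X Y a b s := by
  have := lineAt_le_of_endpoints_le (Y := -Y) (m := -m) (k := -k) hab hs
    (by simp only [Pi.neg_apply]; linarith) (by simp only [Pi.neg_apply]; linarith)
  rw [lineAt_neg] at this
  linarith

/-- A segment that starts strictly below `ef` and ends strictly above it crosses it. -/
lemma SegCross.of_below_above {v x e f : V} (hvx : X v ≠ X x)
    (hv : X v ∈ Set.uIcc (X e) (X f)) (hx : X x ∈ Set.uIcc (X e) (X f))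
    (h1 : Y v < lineAt X Y e f (X v)) (h2 : lineAt X Y e f (X x) < Y x) :
    SegCross X Y v x e f :=
  ⟨X v, X x, Set.left_mem_uIcc, hv, Set.right_mem_uIcc, hx, by simpa using h1,
    by rwa [lineAt_right hvx]⟩

/-- Two segments cross if some point lies below the first and above the second one,
and another point lies below the second and above the first one. -/
lemma SegCross.of_between {v w e f e' f' : V}
    (hv : X v ∈ Set.uIcc (X e) (X f)) (hv' : X v ∈ Set.uIcc (X e') (X f'))
    (hw : X w ∈ Set.uIcc (X e) (X f)) (hw' : X w ∈ Set.uIcc (X e') (X f'))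
    (h1 : Y v < lineAt X Y e f (X v)) (h2 : lineAt X Y e' f' (X v) < Y v)
    (h3 : Y w < lineAt X Y e' f' (X w)) (h4 : lineAt X Y e f (X w) < Y w) :
    SegCross X Y e f e' f' :=
  ⟨X w, X v, hw, hw', hv, hv', h4.trans h3, h2.trans h1⟩

lemma NoThreeOnLine.lt_of_le_lineAt (h : NoThreeOnLine X Y) {a b c : V} (hab : a ≠ b)
    (hca : c ≠ a) (hcb : c ≠ b) (hle : Y c ≤ lineAt X Y a b (X c)) :
    Y c < lineAt X Y a b (X c) :=
  lt_of_le_of_ne hle (h a b c hab hca hcb).symm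

lemma NoThreeOnLine.lineAt_lt_of_le (h : NoThreeOnLine X Y) {a b c : V} (hab : a ≠ b)
    (hca : c ≠ a) (hcb : c ≠ b) (hle : lineAt X Y a b (X c) ≤ Y c) :
    lineAt X Y a b (X c) < Y c :=
  lt_of_le_of_ne hle (h a b c hab hca hcb)

end Ordinates

/-! ### Zigzag paths and criteria for their crossing -/

section Zigzag

variable {V : Type*} {X Y : V → ℝ}

/-- The edges of the path `w 0, w 1, w 2, w 3`. -/
def pathEdges (w : Fin 4 → V) : Set (Sym2 V) := {s(w 0, w 1), s(w 1, w 2), s(w 2, w 3)}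

variable (X Y) in
/-- There are `N` pairwise edge-disjoint and pairwise crossing paths on four vertices. -/
def HasCrossingPaths (N : ℕ) : Prop :=
  ∃ P : Finset (Fin 4 → V), N ≤ P.card ∧ (∀ w ∈ P, Function.Injective w) ∧
    ∀ w ∈ P, ∀ w' ∈ P, w ≠ w' → Disjoint (pathEdges w) (pathEdges w') ∧
      ∃ a b c d, s(a, b) ∈ pathEdges w ∧ s(c, d) ∈ pathEdges w' ∧ SegCross X Y a b c d

lemma HasCrossingPaths.of_neg {N : ℕ} (h : HasCrossingPaths X (-Y) N) :
    HasCrossingPaths X Y N := by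
  obtain ⟨P, h1, h2, h3⟩ := h
  refine ⟨P, h1, h2, fun w hw w' hw' hne => ⟨(h3 w hw w' hw' hne).1, ?_⟩⟩
  obtain ⟨a, b, c, d, h4, h5, h6⟩ := (h3 w hw w' hw' hne).2
  exact ⟨a, b, c, d, h4, h5, h6.of_neg⟩

variable {ι κ : Type*}

/-- The path `e i, g j, f i, h j`. -/
def zigzag (e f : ι → V) (g h : κ → V) (z : ι × κ) : Fin 4 → V :=
  ![e z.1, g z.2, f z.1, h z.2]

/-- The vertices of a family of zigzag paths are all distinct. -/
structure ZigzagInjective (e f : ι → V) (g h : κ → V) : Prop where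
  inj_e : Function.Injective e
  inj_f : Function.Injective f
  inj_g : Function.Injective g
  inj_h : Function.Injective h
  e_ne_f : ∀ i i', e i ≠ f i'
  g_ne_h : ∀ j j', g j ≠ h j'
  e_ne_g : ∀ i j, e i ≠ g j
  e_ne_h : ∀ i j, e i ≠ h j
  f_ne_g : ∀ i j, f i ≠ g j
  f_ne_h : ∀ i j, f i ≠ h j

variable {e f : ι → V} {g h : κ → V}

lemma ZigzagInjective.injective_zigzag (H : ZigzagInjective e f g h) (z : ι × κ) :
    Function.Injective (zigzag e f g h z) := by
  have h1 := H.e_ne_f z.1 z.1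
  have h2 := H.g_ne_h z.2 z.2
  have h3 := H.e_ne_g z.1 z.2
  have h4 := H.e_ne_h z.1 z.2
  have h5 := H.f_ne_g z.1 z.2
  have h6 := H.f_ne_h z.1 z.2
  intro a b hab
  fin_cases a <;> fin_cases b <;> simp_all [zigzag, eq_comm]

/-- Each edge joins a vertex that determines `i` to a vertex that determines `j`, so a shared edge
forces equal indices. -/
lemma ZigzagInjective.disjoint_pathEdges (H : ZigzagInjective e f g h) {z z' : ι × κ}
    (hz : z ≠ z') : Disjoint (pathEdges (zigzag e f g h z)) (pathEdges (zigzag e f g h z')) := by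
  rw [Set.disjoint_left]
  intro a ha hb
  apply hz
  obtain ⟨i, j⟩ := z
  obtain ⟨i', j'⟩ := z'
  have h1 := H.e_ne_f
  have h2 := H.g_ne_h
  have h3 := H.e_ne_g
  have h4 := H.e_ne_h
  have h5 := H.f_ne_g
  have h6 := H.f_ne_h
  have h1' := fun i j => (H.e_ne_f i j).symm
  have h2' := fun i j => (H.g_ne_h i j).symm
  have h3' := fun i j => (H.e_ne_g i j).symm
  have h4' := fun i j => (H.e_ne_h i j).symm
  have h5' := fun i j => (H.f_ne_g i j).symm
  have h6' := fun i j => (H.f_ne_h i j).symm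
  simp only [pathEdges, zigzag, Set.mem_insert_iff, Set.mem_singleton_iff, Matrix.cons_val] at ha hb
  rcases ha with rfl | rfl | rfl <;> rcases hb with hb | hb | hb <;>
    simp_all [H.inj_e.eq_iff, H.inj_f.eq_iff, H.inj_g.eq_iff, H.inj_h.eq_iff]

lemma ZigzagInjective.hasCrossingPaths (H : ZigzagInjective e f g h) (I : Finset (ι × κ))
    (hI : ∀ z ∈ I, ∀ z' ∈ I, z ≠ z' → ∃ a b c d, s(a, b) ∈ pathEdges (zigzag e f g h z) ∧
      s(c, d) ∈ pathEdges (zigzag e f g h z') ∧ SegCross X Y a b c d) :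
    HasCrossingPaths X Y I.card := by
  classical
  refine ⟨I.image (zigzag e f g h), ?_, ?_, ?_⟩
  · rw [Finset.card_image_of_injOn]
    intro z _ z' _ hzz
    have h0 := congrFun hzz 0
    have h1 := congrFun hzz 1
    exact Prod.ext (H.inj_e h0) (H.inj_g h1)
  · simp only [Finset.mem_image]
    rintro _ ⟨z, _, rfl⟩
    exact H.injective_zigzag z
  · simp only [Finset.mem_image]
    rintro _ ⟨z, hz, rfl⟩ _ ⟨z', hz', rfl⟩ hne
    have hne' : z ≠ z' := fun h => hne (by rw [h])
    exact ⟨H.disjoint_pathEdges hne', hI z hz z' hz' hne'⟩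

lemma mem_pathEdges_zigzag (z : ι × κ) :
    s(e z.1, g z.2) ∈ pathEdges (zigzag e f g h z) ∧
    s(g z.2, f z.1) ∈ pathEdges (zigzag e f g h z) ∧
    s(f z.1, h z.2) ∈ pathEdges (zigzag e f g h z) := by
  simp [pathEdges, zigzag]

/-- If every `g j` is below its segment `f i, h j`, while all `e i` are above all these segments,
then the paths cross. -/
lemma ZigzagInjective.hasCrossingPaths_of_below (H : ZigzagInjective e f g h)
    (hpos : NoThreeOnLine X Y) (hX : Function.Injective X) (I : Finset (ι × κ))
    (he : ∀ k i j, X (e k) ∈ Set.uIcc (X (f i)) (X (h j)))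
    (hg : ∀ k i j, X (g k) ∈ Set.uIcc (X (f i)) (X (h j)))
    (habove : ∀ k i j, lineAt X Y (f i) (h j) (X (e k)) < Y (e k))
    (hbelow : ∀ z ∈ I, Y (g z.2) < lineAt X Y (f z.1) (h z.2) (X (g z.2))) :
    HasCrossingPaths X Y I.card := by
  refine H.hasCrossingPaths I fun z hz z' hz' hne => ?_
  obtain ⟨m1, -, m3⟩ := mem_pathEdges_zigzag (e := e) (f := f) (g := g) (h := h) z
  obtain ⟨m1', -, m3'⟩ := mem_pathEdges_zigzag (e := e) (f := f) (g := g) (h := h) z'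
  rw [Sym2.eq_swap] at m1 m1'
  rcases lt_or_ge (Y (g z'.2)) (lineAt X Y (f z.1) (h z.2) (X (g z'.2))) with h1 | h1
  · exact ⟨_, _, _, _, m3, m1', (SegCross.of_below_above (hX.ne (H.e_ne_g _ _).symm)
      (hg _ _ _) (he _ _ _) h1 (habove _ _ _)).symm⟩
  rcases lt_or_ge (Y (g z.2)) (lineAt X Y (f z'.1) (h z'.2) (X (g z.2))) with h2 | h2
  · exact ⟨_, _, _, _, m1, m3', SegCross.of_below_above (hX.ne (H.e_ne_g _ _).symm)
      (hg _ _ _) (he _ _ _) h2 (habove _ _ _)⟩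
  -- Each `g` is now below its own segment and above the other one, so the two segments swap order
  -- between these abscissas.
  refine ⟨_, _, _, _, m3, m3', SegCross.of_between (v := g z.2) (w := g z'.2) (hg _ _ _)
    (hg _ _ _) (hg _ _ _) (hg _ _ _) (hbelow z hz) ?_ (hbelow z' hz') ?_⟩
  · exact hpos.lineAt_lt_of_le (H.f_ne_h _ _) (H.f_ne_g _ _).symm (H.g_ne_h _ _) h2
  · exact hpos.lineAt_lt_of_le (H.f_ne_h _ _) (H.f_ne_g _ _).symm (H.g_ne_h _ _) h1

/-- If every `f i` is above its segment `e i, g j`, while all `g j` are above all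
segments `f i, h j`, then the paths cross. -/
lemma ZigzagInjective.hasCrossingPaths_of_above (H : ZigzagInjective e f g h)
    (hpos : NoThreeOnLine X Y) (hX : Function.Injective X) (I : Finset (ι × κ))
    (hef : ∀ i k, X (e i) < X (f k)) (hfg : ∀ i k, X (f i) < X (g k))
    (hgh : ∀ i k, X (g i) < X (h k))
    (habove : ∀ k i j, lineAt X Y (f i) (h j) (X (g k)) < Y (g k))
    (hown : ∀ z ∈ I, lineAt X Y (e z.1) (g z.2) (X (f z.1)) < Y (f z.1)) :
    HasCrossingPaths X Y I.card := by
  refine H.hasCrossingPaths I fun z hz z' hz' hne => ?_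
  obtain ⟨m1, -, m3⟩ := mem_pathEdges_zigzag (e := e) (f := f) (g := g) (h := h) z
  obtain ⟨m1', -, m3'⟩ := mem_pathEdges_zigzag (e := e) (f := f) (g := g) (h := h) z'
  have memf : ∀ i j k, X (f k) ∈ Set.uIcc (X (e i)) (X (g j)) := fun i j k =>
    Set.Icc_subset_uIcc ⟨(hef i k).le, (hfg k j).le⟩
  have memg : ∀ i j k, X (g k) ∈ Set.uIcc (X (f i)) (X (h j)) := fun i j k =>
    Set.Icc_subset_uIcc ⟨(hfg i k).le, (hgh k j).le⟩
  -- At the abscissa of `g j'` the segment `f i, h j` is the lower one by `habove`; at that of `f i`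
  -- it is the upper one.
  have key : ∀ i j i' j', lineAt X Y (e i') (g j') (X (f i)) < Y (f i) →
      SegCross X Y (f i) (h j) (e i') (g j') := by
    intro i j i' j' h1
    refine ⟨X (g j'), X (f i), memg _ _ _, Set.right_mem_uIcc, Set.left_mem_uIcc, memf _ _ _,
      ?_, ?_⟩
    · rw [lineAt_right (hX.ne (H.e_ne_g _ _))]
      exact habove _ _ _
    · simpa using h1
  rcases lt_or_ge (lineAt X Y (e z'.1) (g z'.2) (X (f z.1))) (Y (f z.1)) with h1 | h1
  · exact ⟨_, _, _, _, m3, m1', key _ _ _ _ h1⟩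
  rcases lt_or_ge (lineAt X Y (e z.1) (g z.2) (X (f z'.1))) (Y (f z'.1)) with h2 | h2
  · exact ⟨_, _, _, _, m1, m3', (key _ _ _ _ h2).symm⟩
  refine ⟨_, _, _, _, m1, m1', SegCross.of_between (v := f z'.1) (w := f z.1) (memf _ _ _)
    (memf _ _ _) (memf _ _ _) (memf _ _ _) ?_ (hown z' hz') ?_ (hown z hz)⟩
  · exact hpos.lt_of_le_lineAt (H.e_ne_g _ _) (H.e_ne_f _ _).symm (H.f_ne_g _ _) h2
  · exact hpos.lt_of_le_lineAt (H.e_ne_g _ _) (H.e_ne_f _ _).symm (H.f_ne_g _ _) h1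

end Zigzag

/-! ### Simultaneous splitting by a line -/

section Bisection

variable {V : Type*}

/-- The `k`-th smallest value of `r` on `B`. -/
noncomputable def kthSmallest (B : Finset V) (k : ℕ) (hk : k + 1 ≤ B.card) (r : V → ℝ) : ℝ :=
  (B.powersetCard (k + 1)).attach.inf'
    (Finset.attach_nonempty_iff.2 (Finset.powersetCard_nonempty.2 hk))
    fun T => T.1.sup' (Finset.card_pos.1 (by
      rw [(Finset.mem_powersetCard.1 T.2).2]; exact k.succ_pos)) r

/-- Ranks count from 0. Writing the value as a minimum of maxima over subsets of size `k + 1` makes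
continuity immediate, even where the ordering changes. -/
lemma continuous_kthSmallest (B : Finset V) (k : ℕ) (hk : k + 1 ≤ B.card) {r : ℝ → V → ℝ}
    (hr : ∀ v, Continuous fun s => r s v) : Continuous fun s => kthSmallest B k hk (r s) := by
  unfold kthSmallest
  refine Continuous.finset_inf'_apply _ fun T _ => ?_
  exact Continuous.finset_sup'_apply _ fun v _ => hr v

lemma le_card_le_kthSmallest (B : Finset V) (k : ℕ) (hk : k + 1 ≤ B.card) (r : V → ℝ) :
    k + 1 ≤ (B.filter fun b => r b ≤ kthSmallest B k hk r).card := by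
  obtain ⟨T, -, hT⟩ := Finset.exists_mem_eq_inf' (s := (B.powersetCard (k + 1)).attach)
    (Finset.attach_nonempty_iff.2 (Finset.powersetCard_nonempty.2 hk))
    (fun T => T.1.sup' (Finset.card_pos.1 (by
      rw [(Finset.mem_powersetCard.1 T.2).2]; exact k.succ_pos)) r)
  obtain ⟨hTB, hTc⟩ := Finset.mem_powersetCard.1 T.2
  rw [← hTc]
  refine Finset.card_le_card fun b hb => Finset.mem_filter.2 ⟨hTB hb, ?_⟩
  unfold kthSmallest
  rw [hT]
  exact Finset.le_sup' r hb

/-- Otherwise `k + 1` elements would lie strictly below the value, and their maximum would undercut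
the minimum. -/
lemma card_kthSmallest_le (B : Finset V) (k : ℕ) (hk : k + 1 ≤ B.card) (r : V → ℝ) :
    B.card ≤ k + (B.filter fun b => kthSmallest B k hk r ≤ r b).card := by
  by_contra! hlt
  have hsum := Finset.card_filter_add_card_filter_not (s := B)
    (fun b => kthSmallest B k hk r ≤ r b)
  have hk' : k + 1 ≤ (B.filter fun b => ¬ kthSmallest B k hk r ≤ r b).card := by omega
  obtain ⟨T, hT, hTc⟩ := Finset.exists_subset_card_eq hk'
  have hTB : T ∈ B.powersetCard (k + 1) :=
    Finset.mem_powersetCard.2 ⟨hT.trans (Finset.filter_subset _ _), hTc⟩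
  have hne : T.Nonempty := Finset.card_pos.1 (by omega)
  have h1 : kthSmallest B k hk r ≤ T.sup' hne r :=
    Finset.inf'_le (s := (B.powersetCard (k + 1)).attach) (b := ⟨T, hTB⟩)
      (fun T => T.1.sup' (Finset.card_pos.1 (by
      rw [(Finset.mem_powersetCard.1 T.2).2]; exact k.succ_pos)) r) (Finset.mem_attach _ _)
  have h2 : T.sup' hne r < kthSmallest B k hk r := by
    rw [Finset.sup'_lt_iff]
    intro b hb
    exact not_le.1 (Finset.mem_filter.1 (hT hb)).2
  exact absurd h1 (not_le.2 h2)

lemma kthSmallest_le_of_forall_le {B C : Finset V} {k l : ℕ} (hk : k + 1 ≤ B.card)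
    (hl : l + 1 ≤ C.card) {r : V → ℝ} (h : ∀ b ∈ B, ∀ c ∈ C, r b ≤ r c) :
    kthSmallest B k hk r ≤ kthSmallest C l hl r := by
  obtain ⟨b, hb⟩ := Finset.card_pos.1
    (show 0 < (B.filter fun b => kthSmallest B k hk r ≤ r b).card by
      have := card_kthSmallest_le B k hk r; omega)
  obtain ⟨c, hc⟩ := Finset.card_pos.1
    (show 0 < (C.filter fun c => r c ≤ kthSmallest C l hl r).card by
      have := le_card_le_kthSmallest C l hl r; omega)
  rw [Finset.mem_filter] at hb hc
  exact hb.2.trans ((h b hb.1 c hc.1).trans hc.2)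

/-- Two finite sets separated by a vertical line can be split simultaneously by a line,
in prescribed proportions. -/
lemma exists_line_split {X Y : V → ℝ} {B C : Finset V} (hBC : ∀ b ∈ B, ∀ c ∈ C, X b < X c)
    {k l : ℕ} (hk : k + 1 ≤ B.card) (hl : l + 1 ≤ C.card) : ∃ m t : ℝ,
      k + 1 ≤ (B.filter fun b => Y b ≤ m * X b + t).card ∧
      B.card ≤ k + (B.filter fun b => m * X b + t ≤ Y b).card ∧
      l + 1 ≤ (C.filter fun c => Y c ≤ m * X c + t).card ∧
      C.card ≤ l + (C.filter fun c => m * X c + t ≤ Y c).card := by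
  let r : ℝ → V → ℝ := fun m v => Y v - m * X v
  have hr : ∀ v, Continuous fun m => r m v := fun v => by fun_prop
  -- `r m v` is the intercept of the line of slope `m` through `v`. Steep slopes of either sign put
  -- all intercepts of one set below those of the other, so the difference of the two order
  -- statistics vanishes for some slope; their common value is the intercept of the line.
  let φ : ℝ → ℝ := fun m => kthSmallest B k hk (r m) - kthSmallest C l hl (r m)
  have hφ : Continuous φ := (continuous_kthSmallest B k hk hr).sub (continuous_kthSmallest C l hl hr)
  have htop : ∃ m, 0 ≤ φ m := by
    have : ∀ᶠ m : ℝ in Filter.atTop, ∀ b ∈ B, ∀ c ∈ C, r m c ≤ r m b := by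
      rw [Finset.eventually_all]
      intro b hb
      rw [Finset.eventually_all]
      intro c hc
      filter_upwards [Filter.eventually_ge_atTop ((Y c - Y b) / (X c - X b))] with m hm
      rw [div_le_iff₀ (sub_pos.2 (hBC b hb c hc))] at hm
      simp only [r]
      linarith
    obtain ⟨m, hm⟩ := this.exists
    exact ⟨m, sub_nonneg.2 (kthSmallest_le_of_forall_le hl hk fun c hc b hb => hm b hb c hc)⟩
  have hbot : ∃ m, φ m ≤ 0 := by
    have : ∀ᶠ m : ℝ in Filter.atBot, ∀ b ∈ B, ∀ c ∈ C, r m b ≤ r m c := by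
      rw [Finset.eventually_all]
      intro b hb
      rw [Finset.eventually_all]
      intro c hc
      filter_upwards [Filter.eventually_le_atBot ((Y c - Y b) / (X c - X b))] with m hm
      rw [le_div_iff₀ (sub_pos.2 (hBC b hb c hc))] at hm
      simp only [r]
      linarith
    obtain ⟨m, hm⟩ := this.exists
    exact ⟨m, sub_nonpos.2 (kthSmallest_le_of_forall_le hk hl hm)⟩
  obtain ⟨m, hm⟩ := mem_range_of_exists_le_of_exists_ge hφ hbot htop
  have e : kthSmallest B k hk (r m) = kthSmallest C l hl (r m) := sub_eq_zero.1 hm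
  have h1 := le_card_le_kthSmallest B k hk (r m)
  have h2 := card_kthSmallest_le B k hk (r m)
  have h3 := le_card_le_kthSmallest C l hl (r m)
  have h4 := card_kthSmallest_le C l hl (r m)
  rw [← e] at h3 h4
  refine ⟨m, kthSmallest B k hk (r m), ?_, ?_, ?_, ?_⟩
  · simpa only [r, sub_le_iff_le_add'] using h1
  · simpa only [r, le_sub_iff_add_le'] using h2
  · simpa only [r, sub_le_iff_le_add'] using h3
  · simpa only [r, le_sub_iff_add_le'] using h4

/-- The `k` leftmost points of a finite set. -/
lemma exists_subset_card_eq_forall_lt [DecidableEq V] {X : V → ℝ} (hX : Function.Injective X)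
    (S : Finset V) {k : ℕ} (hk : k ≤ S.card) :
    ∃ A ⊆ S, A.card = k ∧ ∀ a ∈ A, ∀ b ∈ S \ A, X a < X b := by
  induction k with
  | zero => exact ⟨∅, by simp, by simp, by simp⟩
  | succ k ih =>
    obtain ⟨A, hAS, hA, hlt⟩ := ih (by omega)
    have hne : (S \ A).Nonempty := by
      rw [← Finset.card_pos, Finset.card_sdiff_of_subset hAS]
      omega
    obtain ⟨a, ha, hmin⟩ := Finset.exists_min_image (S \ A) X hne
    have ha' := Finset.mem_sdiff.1 ha
    refine ⟨insert a A, Finset.insert_subset ha'.1 hAS, ?_, ?_⟩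
    · rw [Finset.card_insert_of_notMem ha'.2, hA]
    · intro b hb c hc
      simp only [Finset.mem_sdiff, Finset.mem_insert, not_or] at hc hb
      have hc' : c ∈ S \ A := Finset.mem_sdiff.2 ⟨hc.1, hc.2.2⟩
      rcases hb with rfl | hb
      · exact lt_of_le_of_ne (hmin c hc') (hX.ne (Ne.symm hc.2.1))
      · exact hlt b hb c hc'

lemma exists_injective_fin_of_le_card {S : Finset V} {k : ℕ} (hk : k ≤ S.card) :
    ∃ f : Fin k → V, Function.Injective f ∧ ∀ i, f i ∈ S :=
  ⟨fun i => (S.equivFin.symm (Fin.castLE hk i)).1, fun i j hij => by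
    simpa [Subtype.ext_iff.symm] using hij, fun i => (S.equivFin.symm _).2⟩

end Bisection

/-! ### From vertical order to crossings in the plane -/

section Realization

/-- Coordinates that determine a point of the plane. -/
structure IsCoordinates (ξ η : Plane →ₗ[ℝ] ℝ) : Prop where
  ext : ∀ P Q, ξ P = ξ Q → η P = η Q → P = Q

variable {ξ η : Plane →ₗ[ℝ] ℝ}

lemma lineAt_lineMap {a b : Plane} (hab : ξ a ≠ ξ b) (r : ℝ) :
    lineAt ξ η a b (ξ (AffineMap.lineMap a b r)) = η (AffineMap.lineMap a b r) := by
  have h : ξ b - ξ a ≠ 0 := sub_ne_zero.2 hab.symm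
  simp only [lineAt, AffineMap.lineMap_apply_module', map_add, map_smul, map_sub, smul_eq_mul,
    add_sub_cancel_right]
  field_simp
  ring

lemma IsCoordinates.noThreeOnLine (H : IsCoordinates ξ η) {S : Finset Plane}
    (hS : InGeneralPosition S) (hξ : Set.InjOn ξ S) :
    NoThreeOnLine (fun v : S => ξ v) (fun v : S => η v) := by
  intro a b c hab hca hcb he
  have hne : ξ (a : Plane) ≠ ξ b := fun h => hab (Subtype.ext (hξ a.2 b.2 h))
  have h0 : ξ (b : Plane) - ξ a ≠ 0 := sub_ne_zero.2 hne.symm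
  refine hS a a.2 b b.2 c c.2 (fun h => hab (Subtype.ext h))
    (fun h => hca (Subtype.ext h.symm)) (fun h => hcb (Subtype.ext h.symm)) ?_
  set r := (ξ (c : Plane) - ξ a) / (ξ b - ξ a) with hr
  have hc : (c : Plane) = AffineMap.lineMap (a : Plane) (b : Plane) r := by
    have h1 : ξ (c : Plane) = ξ (AffineMap.lineMap (a : Plane) (b : Plane) r) := by
      simp only [AffineMap.lineMap_apply_module', map_add, map_smul, map_sub, smul_eq_mul, hr]
      field_simp
      ring
    refine H.ext _ _ h1 ?_
    rw [← lineAt_lineMap hne, ← h1]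
    exact he.symm
  rw [collinear_iff_of_mem (p₀ := (a : Plane)) (by simp)]
  refine ⟨(b : Plane) - a, ?_⟩
  simp only [Set.mem_insert_iff, Set.mem_singleton_iff, forall_eq_or_imp, forall_eq]
  refine ⟨⟨0, by simp⟩, ⟨1, by simp⟩, ⟨r, ?_⟩⟩
  rw [hc, AffineMap.lineMap_apply_module']
  simp

lemma exists_mem_openSegment_of_mem_Ioo {a b : Plane} {s : ℝ}
    (hs : min (ξ a) (ξ b) < s ∧ s < max (ξ a) (ξ b)) :
    ∃ P ∈ openSegment ℝ a b, ξ P = s := by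
  have hne : ξ a ≠ ξ b := fun h => by
    rw [h, min_self, max_self] at hs
    exact lt_asymm hs.1 hs.2
  have h0 : ξ b - ξ a ≠ 0 := sub_ne_zero.2 hne.symm
  refine ⟨AffineMap.lineMap a b ((s - ξ a) / (ξ b - ξ a)), ?_, ?_⟩
  · rw [openSegment_eq_image_lineMap]
    refine ⟨_, ?_, rfl⟩
    rcases lt_or_gt_of_ne hne with h | h
    · rw [min_eq_left h.le, max_eq_right h.le] at hs
      have : 0 < ξ b - ξ a := sub_pos.2 h
      exact ⟨div_pos (by linarith) this, (div_lt_one this).2 (by linarith)⟩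
    · rw [min_eq_right h.le, max_eq_left h.le] at hs
      have : ξ b - ξ a < 0 := sub_neg.2 h
      exact ⟨div_pos_of_neg_of_neg (by linarith) this, (div_lt_one_of_neg this).2 (by linarith)⟩
  · simp only [AffineMap.lineMap_apply_module', map_add, map_smul, map_sub, smul_eq_mul]
    field_simp
    ring

lemma lineAt_of_mem_openSegment {a b P : Plane} (hab : ξ a ≠ ξ b) (hP : P ∈ openSegment ℝ a b) :
    lineAt ξ η a b (ξ P) = η P := by
  rw [openSegment_eq_image_lineMap] at hP
  obtain ⟨r, -, rfl⟩ := hP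
  exact lineAt_lineMap hab r

/-- The difference of the two ordinates is affine and changes sign, so it has a unique zero,
strictly between `s` and `t` and thus interior to both segments. -/
lemma IsCoordinates.openSegment_inter_eq_singleton (H : IsCoordinates ξ η) {a b c d : Plane}
    (hab : ξ a ≠ ξ b) (hcd : ξ c ≠ ξ d) (h : SegCross ξ η a b c d) :
    ∃ P, openSegment ℝ a b ∩ openSegment ℝ c d = {P} := by
  obtain ⟨s, t, hs1, hs2, ht1, ht2, h1, h2⟩ := h
  obtain ⟨α, β, hαβ⟩ : ∃ α β : ℝ, ∀ x, lineAt ξ η a b x - lineAt ξ η c d x = α + β * x := by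
    refine ⟨η a - (η b - η a) / (ξ b - ξ a) * ξ a - (η c - (η d - η c) / (ξ d - ξ c) * ξ c),
      (η b - η a) / (ξ b - ξ a) - (η d - η c) / (ξ d - ξ c), fun x => ?_⟩
    simp only [lineAt]
    ring
  have hs := hαβ s
  have ht := hαβ t
  have hst : β * (t - s) > 0 := by nlinarith
  have hβ : β ≠ 0 := fun h => by simp [h] at hst
  have hzero : ∀ x, lineAt ξ η a b x = lineAt ξ η c d x ↔ x = -α / β := by
    intro x
    rw [← sub_eq_zero, hαβ, eq_div_iff hβ]
    constructor <;> intro h <;> linarith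
  have hbetween : min s t < -α / β ∧ -α / β < max s t := by
    have e : β * (-α / β) = -α := by field_simp
    rcases lt_or_gt_of_ne (show s ≠ t by rintro rfl; simp at hst) with h | h
    · have : 0 < β := by
        by_contra! hc
        nlinarith
      rw [min_eq_left h.le, max_eq_right h.le]
      constructor <;> nlinarith
    · have : β < 0 := by
        by_contra! hc
        nlinarith
      rw [min_eq_right h.le, max_eq_left h.le]
      constructor <;> nlinarith
  have inside : ∀ {x y : ℝ}, s ∈ Set.uIcc x y → t ∈ Set.uIcc x y →
      min x y < -α / β ∧ -α / β < max x y := fun hs ht =>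
    ⟨(le_min hs.1 ht.1).trans_lt hbetween.1, hbetween.2.trans_le (max_le hs.2 ht.2)⟩
  obtain ⟨P, hP, hPξ⟩ := exists_mem_openSegment_of_mem_Ioo (inside hs1 ht1)
  obtain ⟨Q, hQ, hQξ⟩ := exists_mem_openSegment_of_mem_Ioo (inside hs2 ht2)
  have hPη := lineAt_of_mem_openSegment (η := η) hab hP
  have hPQ : P = Q := by
    refine H.ext _ _ (hPξ.trans hQξ.symm) ?_
    rw [← hPη, ← lineAt_of_mem_openSegment (η := η) hcd hQ, hPξ, hQξ]
    exact (hzero _).2 rfl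
  refine ⟨P, Set.eq_singleton_iff_unique_mem.2 ⟨⟨hP, hPQ ▸ hQ⟩, ?_⟩⟩
  rintro R ⟨hR1, hR2⟩
  have hR1' := lineAt_of_mem_openSegment (η := η) hab hR1
  have hR2' := lineAt_of_mem_openSegment (η := η) hcd hR2
  have hRξ := (hzero _).1 (hR1'.trans hR2'.symm)
  refine H.ext _ _ (hRξ.trans hPξ.symm) ?_
  rw [← hR1', ← hPη, hRξ, hPξ]

/-- A finite set of points has distinct abscissas in suitable coordinates. -/
lemma exists_isCoordinates_injOn (S : Finset Plane) :
    ∃ ξ η : Plane →ₗ[ℝ] ℝ, IsCoordinates ξ η ∧ Set.InjOn ξ S := by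
  classical
  let p : Fin 2 → (Plane →ₗ[ℝ] ℝ) := fun i => (EuclideanSpace.proj i : Plane →L[ℝ] ℝ).toLinearMap
  have hp : ∀ i P, p i P = P i := fun i P => rfl
  -- Only finitely many shears `x + ε y` identify two points with different second coordinates;
  -- points with equal second coordinates stay apart for every `ε`.
  obtain ⟨ε, hε⟩ := Infinite.exists_notMem_finset
    ((S ×ˢ S).image fun z => -(z.1 0 - z.2 0) / (z.1 1 - z.2 1))
  refine ⟨p 0 + ε • p 1, p 1, ⟨fun P Q h1 h2 => ?_⟩, fun P hP Q hQ h => ?_⟩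
  · simp only [LinearMap.add_apply, LinearMap.smul_apply, hp, smul_eq_mul] at h1 h2
    ext i
    fin_cases i
    · simp only [h2] at h1
      simpa using h1
    · simpa using h2
  · simp only [LinearMap.add_apply, LinearMap.smul_apply, hp, smul_eq_mul] at h
    by_cases h1 : P 1 = Q 1
    · ext i
      fin_cases i
      · simpa [h1] using h
      · simpa using h1
    · refine absurd (Finset.mem_image.2 ⟨(P, Q), Finset.mem_product.2 ⟨hP, hQ⟩, ?_⟩) hε
      rw [div_eq_iff (sub_ne_zero.2 h1)]
      simp only
      linarith

end Realization

/-! ### From vertex sequences to subgraphs -/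

section Paths

variable {V : Type*} {G : SimpleGraph V}

/-- The path through four distinct pairwise adjacent vertices. -/
def pathCopy (w : Fin 4 → V) (hw : Function.Injective w)
    (hG : ∀ u v, u ≠ v → G.Adj u v) : SimpleGraph.Copy (SimpleGraph.pathGraph 4) G where
  toHom := ⟨w, fun h => hG _ _ (hw.ne h.ne)⟩
  injective' := hw

lemma edgeSet_pathCopy (w : Fin 4 → V) (hw : Function.Injective w)
    (hG : ∀ u v, u ≠ v → G.Adj u v) :
    (pathCopy w hw hG).toSubgraph.edgeSet = pathEdges w := by
  ext z
  induction z with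
  | _ a b =>
    simp only [SimpleGraph.Subgraph.mem_edgeSet, SimpleGraph.Subgraph.map_adj, Relation.Map,
      SimpleGraph.Subgraph.top_adj, SimpleGraph.pathGraph_adj, pathEdges, Set.mem_insert_iff,
      Set.mem_singleton_iff, Sym2.eq_iff]
    constructor
    · rintro ⟨i, j, hij, rfl, rfl⟩
      fin_cases i <;> fin_cases j <;> simp [pathCopy] at hij ⊢
    · have h01 : (0 : Fin 4).val + 1 = (1 : Fin 4).val := rfl
      have h12 : (1 : Fin 4).val + 1 = (2 : Fin 4).val := rfl
      have h23 : (2 : Fin 4).val + 1 = (3 : Fin 4).val := rfl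
      rintro ((⟨rfl, rfl⟩ | ⟨rfl, rfl⟩) | (⟨rfl, rfl⟩ | ⟨rfl, rfl⟩) | (⟨rfl, rfl⟩ | ⟨rfl, rfl⟩))
      exacts [⟨0, 1, Or.inl h01, rfl, rfl⟩, ⟨1, 0, Or.inr h01, rfl, rfl⟩,
        ⟨1, 2, Or.inl h12, rfl, rfl⟩, ⟨2, 1, Or.inr h12, rfl, rfl⟩,
        ⟨2, 3, Or.inl h23, rfl, rfl⟩, ⟨3, 2, Or.inr h23, rfl, rfl⟩]

lemma HasCrossingPaths.exists_isIntersectingFamily {G : GeometricGraph} (hG : G.IsComplete)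
    {ξ η : Plane →ₗ[ℝ] ℝ} (H : IsCoordinates ξ η) (hξ : Set.InjOn ξ G.verts) {N : ℕ}
    (h : HasCrossingPaths (fun v : G.verts => ξ v) (fun v : G.verts => η v) N) :
    ∃ F : Finset G.graph.Subgraph,
      G.IsIntersectingFamily (SimpleGraph.pathGraph 4) F ∧ N ≤ F.card := by
  classical
  obtain ⟨P, hN, hinj, hP⟩ := h
  let φ : P → G.graph.Subgraph := fun w => (pathCopy w.1 (hinj w.1 w.2) hG).toSubgraph
  have hφ : ∀ w, (φ w).edgeSet = pathEdges w.1 := fun w => edgeSet_pathCopy _ _ _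
  -- Two sequences may a priori trace the same subgraph; disjointness of their nonempty edge sets
  -- excludes this.
  have hφinj : Function.Injective φ := by
    intro w w' hww
    by_contra hne
    have h1 := (hP w.1 w.2 w'.1 w'.2 (fun h => hne (Subtype.ext h))).1
    rw [← hφ, ← hφ, hww, disjoint_self, hφ] at h1
    exact Set.insert_nonempty _ _ |>.ne_empty h1
  refine ⟨Finset.univ.image φ, ⟨?_, ?_, ?_⟩, ?_⟩
  · simp only [Finset.mem_image]
    rintro _ ⟨w, -, rfl⟩
    exact ⟨(pathCopy w.1 (hinj w.1 w.2) hG).isoToSubgraph⟩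
  · simp only [Finset.mem_image]
    rintro _ ⟨w, -, rfl⟩ _ ⟨w', -, rfl⟩ hne
    rw [hφ, hφ]
    exact (hP w.1 w.2 w'.1 w'.2 (fun h => hne (by rw [Subtype.ext h]))).1
  · simp only [Finset.mem_image]
    rintro _ ⟨w, -, rfl⟩ _ ⟨w', -, rfl⟩ hne
    obtain ⟨a, b, c, d, h1, h2, h3⟩ :=
      (hP w.1 w.2 w'.1 w'.2 (fun h => hne (by rw [Subtype.ext h]))).2
    rw [← hφ, SimpleGraph.Subgraph.mem_edgeSet] at h1 h2
    refine ⟨a, b, c, d, h1, h2, H.openSegment_inter_eq_singleton ?_ ?_ h3⟩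
    · exact fun h => h1.ne (Subtype.ext (hξ a.2 b.2 h))
    · exact fun h => h2.ne (Subtype.ext (hξ c.2 d.2 h))
  · rw [Finset.card_image_of_injective _ hφinj]
    simpa using hN

end Paths

/-! ### Choice of the class sizes -/

section Parameters

/-- Admissible sizes of the point classes used in the construction of `N` paths among `n` points. -/
def IsAdmissible (n N p q u v x : ℕ) : Prop :=
  2 * N ≤ p * q + 1 ∧ N ≤ u * v ∧ q ≤ x ∧ u ≤ x ∧ 1 ≤ p ∧ 1 ≤ q ∧ 1 ≤ u ∧ 1 ≤ v ∧
    2 * x + 4 * p + 4 * q + 2 * u + 4 * v ≤ n + 9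

instance (n N p q u v x : ℕ) : Decidable (IsAdmissible n N p q u v x) := by
  unfold IsAdmissible
  infer_instance

/-- With `n = k + 21` and `N = ⌈n² / 400⌉`, the sizes are `q = u = x = ⌈3n / 50⌉`, `p = ⌈(2N - 1) /
q⌉` and `v = ⌈N / q⌉`. -/
lemma isAdmissible_of_lt : ∀ k < 300,
    IsAdmissible (k + 21) (((k + 21) ^ 2 + 399) / 400)
      ((2 * (((k + 21) ^ 2 + 399) / 400) + (3 * k + 112) / 50 - 2) / ((3 * k + 112) / 50))
      ((3 * k + 112) / 50) ((3 * k + 112) / 50)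
      ((((k + 21) ^ 2 + 399) / 400 + (3 * k + 112) / 50 - 1) / ((3 * k + 112) / 50))
      ((3 * k + 112) / 50) := by
  decide +kernel

lemma exists_isAdmissible {n : ℕ} (hn : 21 ≤ n) :
    ∃ p q u v x, IsAdmissible n ((n ^ 2 + 399) / 400) p q u v x := by
  rcases lt_or_ge n 321 with h | h
  · obtain ⟨k, rfl⟩ := Nat.exists_eq_add_of_le' hn
    exact ⟨_, _, _, _, _, isAdmissible_of_lt k (by omega)⟩
  -- With `q = u = x ≈ 3n/50`, `p ≈ n/12`, `v ≈ n/24`, one has `pq ≈ n²/200` and `uv ≈ n²/400`,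
  -- while the size sum is about `49n/50`. The slack `n/50 + 9` absorbs the rounding for `n ≥ 321`.
  obtain ⟨q, hq⟩ : ∃ q, q = (3 * n + 49) / 50 := ⟨_, rfl⟩
  obtain ⟨p, hp⟩ : ∃ p, p = (n + 11) / 12 := ⟨_, rfl⟩
  obtain ⟨v, hv⟩ : ∃ v, v = (n + 23) / 24 := ⟨_, rfl⟩
  have hpq : n ^ 2 ≤ 200 * (p * q) := by
    nlinarith [Nat.mul_le_mul (show n ≤ 12 * p by omega) (show 3 * n ≤ 50 * q by omega)]
  have hqv : n ^ 2 ≤ 400 * (q * v) := by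
    nlinarith [Nat.mul_le_mul (show n ≤ 24 * v by omega) (show 3 * n ≤ 50 * q by omega)]
  refine ⟨p, q, q, v, q, ?_, ?_, le_rfl, le_rfl, ?_, ?_, ?_, ?_, ?_⟩ <;> omega

end Parameters

/-! ### The two bisections and the case distinction -/

section Construction

variable {V : Type*} {X Y : V → ℝ}

lemma HasCrossingPaths.mono {N N' : ℕ} (h : HasCrossingPaths X Y N') (hN : N ≤ N') :
    HasCrossingPaths X Y N := by
  obtain ⟨P, h1, h2⟩ := h
  exact ⟨P, hN.trans h1, h2⟩

lemma hasCrossingPaths_of_above_line (hpos : NoThreeOnLine X Y) (hX : Function.Injective X)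
    {n N p q u v k : ℕ} (hadm : IsAdmissible n N p q u v k) {L M R : Finset V}
    (hL : 2 * p + u ≤ L.card + 1) (hR : 2 * q + 2 * v ≤ R.card + 2) (hM : k ≤ M.card)
    (hLM : ∀ a ∈ L, ∀ x ∈ M, X a < X x) (hMR : ∀ x ∈ M, ∀ b ∈ R, X x < X b) {m t : ℝ}
    (hLt : ∀ a ∈ L, Y a ≤ m * X a + t) (hRt : ∀ a ∈ R, Y a ≤ m * X a + t)
    (hMt : ∀ x ∈ M, m * X x + t ≤ Y x) : HasCrossingPaths X Y N := by
  classical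
  obtain ⟨hpq, huv, hqk, huk, hp, hq, hu, hv, -⟩ := hadm
  have hcard : 0 < M.card := by omega
  obtain ⟨x₀, hx₀⟩ := Finset.card_pos.1 hcard
  have hLR : ∀ a ∈ L, ∀ b ∈ R, X a < X b := fun a ha b hb =>
    (hLM a ha x₀ hx₀).trans (hMR x₀ hx₀ b hb)
  have habove : ∀ a ∈ L, ∀ x ∈ M, ∀ b ∈ R, lineAt X Y a b (X x) < Y x := by
    intro a ha x hx b hb
    have h1 := hLM a ha x hx
    have h2 := hMR x hx b hb
    refine hpos.lineAt_lt_of_le (fun h => (hLR a ha b hb).ne (congrArg X h))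
      (fun h => h1.ne' (congrArg X h)) (fun h => h2.ne (congrArg X h)) ?_
    exact (lineAt_le_of_endpoints_le (h1.trans h2) ⟨h1.le, h2.le⟩ (hLt a ha) (hRt b hb)).trans
      (hMt x hx)
  obtain ⟨A, hAL, hA, hAB⟩ := exists_subset_card_eq_forall_lt hX L (show p ≤ L.card by omega)
  obtain ⟨C, hCR, hC, hCD⟩ := exists_subset_card_eq_forall_lt hX R
    (show q + v - 1 ≤ R.card by omega)
  obtain ⟨B, hB⟩ : ∃ B, B = L \ A := ⟨_, rfl⟩
  obtain ⟨D, hD⟩ : ∃ D, D = R \ C := ⟨_, rfl⟩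
  rw [← hB] at hAB
  rw [← hD] at hCD
  have hBcard : p + u ≤ B.card + 1 := by
    rw [hB, Finset.card_sdiff_of_subset hAL]
    omega
  have hDcard : q + v ≤ D.card + 1 := by
    rw [hD, Finset.card_sdiff_of_subset hCR]
    omega
  have hBL : B ⊆ L := hB ▸ Finset.sdiff_subset
  have hDR : D ⊆ R := hD ▸ Finset.sdiff_subset
  -- The second line leaves at least `p` points of `B` below and `u` above, and at least `v` points
  -- of `C` below and `q` above. Then `D` has `v` points above or `q` strictly below.
  obtain ⟨m', t', hB1, hB2, hC1, hC2⟩ := exists_line_split (X := X) (Y := Y) (B := B) (C := C)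
    (fun b hb c hc => hLR b (hBL hb) c (hCR hc)) (k := p - 1) (l := v - 1) (by omega) (by omega)
  by_cases hcase : v ≤ (D.filter fun d => m' * X d + t' ≤ Y d).card
  -- High points of `B` and `D` span segments passing over the low points of `C` and under `M`; this
  -- gives `u * v` paths.
  · obtain ⟨e, he, heM⟩ := exists_injective_fin_of_le_card (show u ≤ M.card by omega)
    obtain ⟨f, hf, hfB⟩ := exists_injective_fin_of_le_card
      (show u ≤ (B.filter fun b => m' * X b + t' ≤ Y b).card by omega)
    obtain ⟨g, hg, hgC⟩ := exists_injective_fin_of_le_card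
      (show v ≤ (C.filter fun c => Y c ≤ m' * X c + t').card by omega)
    obtain ⟨h, hh, hhD⟩ := exists_injective_fin_of_le_card hcase
    simp only [Finset.mem_filter] at hfB hgC hhD
    have hfe : ∀ i k, X (f i) < X (e k) := fun i k => hLM _ (hBL (hfB i).1) _ (heM k)
    have heg : ∀ i j, X (e i) < X (g j) := fun i j => hMR _ (heM i) _ (hCR (hgC j).1)
    have hgh : ∀ j k, X (g j) < X (h k) := fun j k => hCD _ (hgC j).1 _ (hhD k).1
    have hinj : ZigzagInjective e f g h :=
      { inj_e := he
        inj_f := hf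
        inj_g := hg
        inj_h := hh
        e_ne_f := fun i k h => (hfe k i).ne' (congrArg X h)
        g_ne_h := fun i k h => (hgh i k).ne (congrArg X h)
        e_ne_g := fun i k h => (heg i k).ne (congrArg X h)
        e_ne_h := fun i k h => ((heg i k).trans (hgh k k)).ne (congrArg X h)
        f_ne_g := fun i k h => ((hfe i i).trans (heg i k)).ne (congrArg X h)
        f_ne_h := fun i k h => ((hfe i i).trans ((heg i k).trans (hgh k k))).ne (congrArg X h) }
    have main := hinj.hasCrossingPaths_of_below hpos hX Finset.univ
      (fun k i j => Set.Icc_subset_uIcc ⟨(hfe i k).le, ((heg k j).trans (hgh j j)).le⟩)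
      (fun k i j => Set.Icc_subset_uIcc ⟨((hfe i i).trans (heg i k)).le, (hgh k j).le⟩)
      (fun k i j => habove _ (hBL (hfB i).1) _ (heM k) _ (hDR (hhD j).1))
      (fun z _ => by
        have h1 := (hfe z.1 z.1).trans (heg z.1 z.2)
        have h2 := hgh z.2 z.2
        refine hpos.lt_of_le_lineAt (hinj.f_ne_h _ _) (hinj.f_ne_g _ _).symm (hinj.g_ne_h _ _) ?_
        exact (hgC _).2.trans (le_lineAt_of_le_endpoints (h1.trans h2) ⟨h1.le, h2.le⟩
          (hfB _).2 (hhD _).2))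
    refine main.mono ?_
    simpa using huv
  · have hD1 : q ≤ (D.filter fun d => ¬ m' * X d + t' ≤ Y d).card := by
      have := Finset.card_filter_add_card_filter_not (s := D) (fun d => m' * X d + t' ≤ Y d)
      omega
    obtain ⟨a, ha, haA⟩ := exists_injective_fin_of_le_card hA.ge
    obtain ⟨b, hb, hbB⟩ := exists_injective_fin_of_le_card
      (show p ≤ (B.filter fun b => Y b ≤ m' * X b + t').card by omega)
    obtain ⟨c, hc, hcC⟩ := exists_injective_fin_of_le_card
      (show q ≤ (C.filter fun c => m' * X c + t' ≤ Y c).card by omega)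
    obtain ⟨d, hd, hdD⟩ := exists_injective_fin_of_le_card hD1
    obtain ⟨x, hx, hxM⟩ := exists_injective_fin_of_le_card (show q ≤ M.card by omega)
    simp only [Finset.mem_filter, not_le] at hbB hcC hdD
    have hab : ∀ i k, X (a i) < X (b k) := fun i k => hAB _ (haA i) _ (hbB k).1
    have hbx : ∀ i k, X (b i) < X (x k) := fun i k => hLM _ (hBL (hbB i).1) _ (hxM k)
    have hxc : ∀ i k, X (x i) < X (c k) := fun i k => hMR _ (hxM i) _ (hCR (hcC k).1)
    have hcd : ∀ i k, X (c i) < X (d k) := fun i k => hCD _ (hcC i).1 _ (hdD k).1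
    have hbc : ∀ i k, X (b i) < X (c k) := fun i k => (hbx i k).trans (hxc k k)
    have hac : ∀ i k, X (a i) < X (c k) := fun i k => (hab i i).trans (hbc i k)
    -- Each pair is sorted by whether `b i` lies below the segment `a i, c j`. As `2 * N ≤ p * q +
    -- 1`, one class has at least `N` pairs.
    let I : Finset (Fin p × Fin q) := Finset.univ.filter fun z =>
      Y (b z.1) < lineAt X Y (a z.1) (c z.2) (X (b z.1))
    let J : Finset (Fin p × Fin q) := Finset.univ.filter fun z =>
      ¬ Y (b z.1) < lineAt X Y (a z.1) (c z.2) (X (b z.1))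
    have hIJ : I.card + J.card = p * q := by
      have := Finset.card_filter_add_card_filter_not (s := (Finset.univ : Finset (Fin p × Fin q)))
        (fun z => Y (b z.1) < lineAt X Y (a z.1) (c z.2) (X (b z.1)))
      simpa [I, J] using this
    by_cases hI : N ≤ I.card
    -- The paths `x j, b i, c j, a i` work here: `b i` is below `a i, c j`, and `M` is above all
    -- such segments. The index order is swapped.
    · have hinj : ZigzagInjective x c b a :=
        { inj_e := hx
          inj_f := hc
          inj_g := hb
          inj_h := ha
          e_ne_f := fun i k h => (hxc i k).ne (congrArg X h)
          g_ne_h := fun i k h => (hab k i).ne' (congrArg X h)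
          e_ne_g := fun i k h => (hbx k i).ne' (congrArg X h)
          e_ne_h := fun i k h => ((hab k k).trans (hbx k i)).ne' (congrArg X h)
          f_ne_g := fun i k h => (hbc k i).ne' (congrArg X h)
          f_ne_h := fun i k h => (hac k i).ne' (congrArg X h) }
      have main := hinj.hasCrossingPaths_of_below hpos hX
        (I.map (Equiv.prodComm _ _).toEmbedding)
        (fun k i j => Set.mem_uIcc_of_ge ((hab j j).trans (hbx j k)).le (hxc k i).le)
        (fun k i j => Set.mem_uIcc_of_ge (hab j k).le (hbc k i).le)
        (fun k i j => by
          rw [lineAt_comm (hac j i).ne']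
          exact habove _ (hAL (haA j)) _ (hxM k) _ (hCR (hcC i).1))
        (fun z hz => by
          rw [lineAt_comm (hac z.2 z.1).ne']
          obtain ⟨w, hw, rfl⟩ := Finset.mem_map.1 hz
          exact (Finset.mem_filter.1 hw).2)
      rw [Finset.card_map] at main
      exact main.mono hI
    -- The paths `a i, c j, b i, d j` work here: `b i` is above `a i, c j`, and each `c` is above
    -- all segments `b i, d j`, whose ends lie below the second line.
    · have hinj : ZigzagInjective a b c d :=
        { inj_e := ha
          inj_f := hb
          inj_g := hc
          inj_h := hd
          e_ne_f := fun i k h => (hab i k).ne (congrArg X h)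
          g_ne_h := fun i k h => (hcd i k).ne (congrArg X h)
          e_ne_g := fun i k h => (hac i k).ne (congrArg X h)
          e_ne_h := fun i k h => ((hac i k).trans (hcd k k)).ne (congrArg X h)
          f_ne_g := fun i k h => (hbc i k).ne (congrArg X h)
          f_ne_h := fun i k h => ((hbc i k).trans (hcd k k)).ne (congrArg X h) }
      have main := hinj.hasCrossingPaths_of_above hpos hX J hab hbc hcd
        (fun k i j => by
          have h1 := hbc i k
          have h2 := hcd k j
          refine hpos.lineAt_lt_of_le (hinj.f_ne_h _ _) (hinj.f_ne_g _ _).symm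
            (hinj.g_ne_h _ _) ?_
          exact (lineAt_le_of_endpoints_le (h1.trans h2) ⟨h1.le, h2.le⟩ (hbB _).2
            (hdD _).2.le).trans (hcC _).2)
        (fun z hz => hpos.lineAt_lt_of_le (hinj.e_ne_g _ _) (hinj.e_ne_f _ _).symm
            (hinj.f_ne_g _ _) (not_lt.1 (Finset.mem_filter.1 hz).2))
      exact main.mono (by omega)

lemma hasCrossingPaths_of_isAdmissible [Fintype V] (hpos : NoThreeOnLine X Y)
    (hX : Function.Injective X) {N p q u v k : ℕ}
    (hadm : IsAdmissible (Fintype.card V) N p q u v k) : HasCrossingPaths X Y N := by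
  classical
  obtain ⟨-, -, hqk, huk, hp, hq, hu, hv, hsize⟩ := id hadm
  obtain ⟨L, -, hL, hL'⟩ := exists_subset_card_eq_forall_lt hX Finset.univ
    (show 4 * p + 2 * u - 3 ≤ (Finset.univ : Finset V).card by rw [Finset.card_univ]; omega)
  obtain ⟨S, hS⟩ : ∃ S, S = Finset.univ \ L := ⟨_, rfl⟩
  have hScard : S.card = Fintype.card V - (4 * p + 2 * u - 3) := by
    rw [hS, Finset.card_sdiff_of_subset (Finset.subset_univ _), hL, Finset.card_univ]
  obtain ⟨M, hMS, hM, hM'⟩ := exists_subset_card_eq_forall_lt hX S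
    (show S.card - (4 * q + 4 * v - 5) ≤ S.card by omega)
  obtain ⟨R, hR⟩ : ∃ R, R = S \ M := ⟨_, rfl⟩
  have hRcard : R.card = 4 * q + 4 * v - 5 := by
    rw [hR, Finset.card_sdiff_of_subset hMS, hM]
    omega
  rw [← hS] at hL'
  rw [← hR] at hM'
  have hRS : R ⊆ S := hR ▸ Finset.sdiff_subset
  -- The odd sizes of `L` and `R` leave at least `2p + u - 1` and `2q + 2v - 2` points on each
  -- closed side. `M` keeps at least `2k - 1` points, so one side of the line contains `k` of them.
  obtain ⟨m, t, hL1, hL2, hR1, hR2⟩ := exists_line_split (X := X) (Y := Y) (B := L) (C := R)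
    (fun b hb c hc => hL' b hb c (hRS hc)) (k := 2 * p + u - 2) (l := 2 * q + 2 * v - 3)
    (by omega) (by omega)
  by_cases hcase : k ≤ (M.filter fun x => m * X x + t ≤ Y x).card
  · refine hasCrossingPaths_of_above_line hpos hX hadm (m := m) (t := t)
      (L := L.filter fun b => Y b ≤ m * X b + t) (R := R.filter fun b => Y b ≤ m * X b + t)
      (by omega) (by omega) hcase ?_ ?_ ?_ ?_ ?_ <;> simp only [Finset.mem_filter]
    · exact fun a ha b hb => hL' _ ha.1 _ (hMS hb.1)
    · exact fun a ha b hb => hM' _ ha.1 _ hb.1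
    · exact fun a ha => ha.2
    · exact fun a ha => ha.2
    · exact fun a ha => ha.2
  · have hcase' : k ≤ (M.filter fun x => ¬ m * X x + t ≤ Y x).card := by
      have := Finset.card_filter_add_card_filter_not (s := M) (fun x => m * X x + t ≤ Y x)
      omega
    refine (hasCrossingPaths_of_above_line hpos.neg hX hadm (m := -m) (t := -t)
      (L := L.filter fun b => m * X b + t ≤ Y b) (R := R.filter fun b => m * X b + t ≤ Y b)
      (by omega) (by omega) hcase' ?_ ?_ ?_ ?_ ?_).of_neg <;>
      simp only [Finset.mem_filter, Pi.neg_apply]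
    · exact fun a ha b hb => hL' _ ha.1 _ (hMS hb.1)
    · exact fun a ha b hb => hM' _ ha.1 _ hb.1
    · exact fun a ha => by linarith [ha.2]
    · exact fun a ha => by linarith [ha.2]
    · exact fun a ha => by linarith [not_le.1 ha.2]

lemma hasCrossingPaths_one [Fintype V] (hV : 4 ≤ Fintype.card V) : HasCrossingPaths X Y 1 := by
  obtain ⟨f⟩ := Function.Embedding.nonempty_of_card_le (α := Fin 4) (β := V) (by simpa using hV)
  refine ⟨{⇑f}, by simp, by simp [f.injective], ?_⟩
  simp only [Finset.mem_singleton]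
  rintro _ rfl _ rfl h
  exact absurd rfl h

end Construction

theorem mainTheorem9 (n : ℕ) (hn : 4 ≤ n) (G : GeometricGraph)
    (hcard : G.verts.card = n) (hpos : InGeneralPosition G.verts) (hcomplete : G.IsComplete) :
    ∃ F : Finset G.graph.Subgraph,
      G.IsIntersectingFamily (SimpleGraph.pathGraph 4) F ∧ (n : ℝ) ^ 2 / 400 ≤ (F.card : ℝ) := by
  obtain ⟨ξ, η, H, hξ⟩ := exists_isCoordinates_injOn G.verts
  have hV : Fintype.card G.verts = n := by simpa using hcard
  have key : HasCrossingPaths (fun v : G.verts => ξ v) (fun v : G.verts => η v)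
      ((n ^ 2 + 399) / 400) := by
    -- For `n ≤ 20` the bound `⌈n² / 400⌉` is 1, and a single path suffices.
    rcases lt_or_ge n 21 with h | h
    · refine (hasCrossingPaths_one (hV.symm ▸ hn)).mono ?_
      have : n ^ 2 ≤ 20 ^ 2 := Nat.pow_le_pow_left (by omega) 2
      omega
    · obtain ⟨p, q, u, v, k, hadm⟩ := exists_isAdmissible h
      refine hasCrossingPaths_of_isAdmissible (H.noThreeOnLine hpos hξ) ?_ (by rwa [hV])
      exact fun a b hab => Subtype.ext (hξ a.2 b.2 hab)
  obtain ⟨F, hF, hN⟩ := key.exists_isIntersectingFamily hcomplete H hξ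
  refine ⟨F, hF, ?_⟩
  have h1 : n ^ 2 ≤ 400 * F.card := by omega
  have h2 : (n : ℝ) ^ 2 ≤ 400 * (F.card : ℝ) := by exact_mod_cast h1
  linarith
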